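/- Let $J$ be any set (possibly uncountable), let $\mathbb{F}_J$ be the free group on the set of generators $J$, and let $L(\mathbb{F}_J) \subseteq \mathcal{B}(\ell^2(\mathbb{F}_J))$ be its group von Neumann algebra, i.e. the von Neumann algebra generated by the operators $\lambda_g$, $g \in \mathbb{F}_J$, of the left regular representation, $(\lambda_g f)(h) = f(g^{-1}h)$. Let $\theta$ be a $*$-automorphism of $L(\mathbb{F}_J)$ which is locally inner: for every $x \in L(\mathbb{F}_J)$ there is a unitary $u_x \in L(\mathbb{F}_J)$, possibly depending on $x$, such that $\theta(x) = u_x x u_x^*$. Then $\theta$ is inner: there is a single unitary $u \in L(\mathbb{F}_J)$ such that $\theta(x) = u x u^*$ for all $x \in L(\mathbb{F}_J)$. -/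

import Mathlib

open scoped ENNReal

noncomputable section

/-- The Hilbert space `ℓ²(G)` of square-summable complex functions on `G`. -/
abbrev EllTwo (G : Type*) : Type _ := lp (fun _ : G => ℂ) 2

theorem memℓp_two_comp_equiv {G : Type*} (e : G ≃ G) (f : EllTwo G) :
    Memℓp (fun h : G => f (e h)) 2 := by
  have hf := lp.memℓp f
  rw [memℓp_gen_iff (by norm_num)] at hf ⊢
  exact (e.summable_iff (f := fun h : G => ‖f h‖ ^ (2 : ℝ≥0∞).toReal)).2 hf

/-- The left regular representation of `G` on `ℓ²(G)`: `(λ_g f)(h) = f (g⁻¹ h)`,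
so that `λ_g δ_h = δ_{gh}`. -/
def leftRegular {G : Type*} [Group G] (g : G) : EllTwo G →L[ℂ] EllTwo G :=
  LinearIsometry.toContinuousLinearMap
    { toFun := fun f =>
        (⟨fun h : G => f (g⁻¹ * h), memℓp_two_comp_equiv (Equiv.mulLeft g⁻¹) f⟩ : EllTwo G)
      map_add' := fun _ _ => rfl
      map_smul' := fun _ _ => rfl
      norm_map' := fun f => by
        have h2 : 0 < (2 : ℝ≥0∞).toReal := by norm_num
        rw [lp.norm_eq_tsum_rpow h2, lp.norm_eq_tsum_rpow h2]
        congr 1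
        exact (Equiv.mulLeft g⁻¹).tsum_eq (fun h : G => ‖f h‖ ^ (2 : ℝ≥0∞).toReal) }

theorem leftRegular_apply {G : Type*} [Group G] (g : G) (f : EllTwo G) (h : G) :
    leftRegular g f h = f (g⁻¹ * h) := rfl

/-- The (unital) von Neumann algebra `W*(S) = (S ∪ S*)''` generated by a set `S` of bounded
operators on a Hilbert space. -/
def vonNeumannGenerated {H : Type*} [NormedAddCommGroup H] [InnerProductSpace ℂ H]
    [CompleteSpace H] (S : Set (H →L[ℂ] H)) : VonNeumannAlgebra H where
  toStarSubalgebra :=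
    StarSubalgebra.centralizer ℂ (StarSubalgebra.centralizer ℂ S : Set (H →L[ℂ] H))
  centralizer_centralizer' := by simp

theorem coe_vonNeumannGenerated {H : Type*} [NormedAddCommGroup H] [InnerProductSpace ℂ H]
    [CompleteSpace H] (S : Set (H →L[ℂ] H)) :
    (vonNeumannGenerated S : Set (H →L[ℂ] H)) =
      Set.centralizer (Set.centralizer (S ∪ star S)) := by
  have h : (StarSubalgebra.centralizer ℂ S : Set (H →L[ℂ] H)) ∪
      star (StarSubalgebra.centralizer ℂ S : Set (H →L[ℂ] H)) =
      (StarSubalgebra.centralizer ℂ S : Set (H →L[ℂ] H)) := by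
    refine Set.union_eq_left.2 fun x hx => ?_
    have hx' : star x ∈ StarSubalgebra.centralizer ℂ S := hx
    exact star_star x ▸ star_mem hx'
  change ((StarSubalgebra.centralizer ℂ (StarSubalgebra.centralizer ℂ S : Set (H →L[ℂ] H)) :
    StarSubalgebra ℂ (H →L[ℂ] H)) : Set (H →L[ℂ] H)) = _
  rw [StarSubalgebra.coe_centralizer, h, StarSubalgebra.coe_centralizer]

/-- The group von Neumann algebra `L(G)`, generated by the left regular representation. -/
def groupVonNeumannAlgebra (G : Type*) [Group G] : VonNeumannAlgebra (EllTwo G) :=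
  vonNeumannGenerated (Set.range (leftRegular (G := G)))

/-- The underlying star-algebra of `L(F_J)`, where `F_J` is the free group on the set `J`. -/
abbrev FreeGroupFactor (J : Type*) : Type _ :=
  ↥(groupVonNeumannAlgebra (FreeGroup J)).toStarSubalgebra

/-- A *-automorphism is inner if it is `x ↦ u x u*` for one unitary `u` of the algebra. -/
def IsInnerAut {A : Type*} [Ring A] [StarRing A] [Algebra ℂ A] (θ : A ≃⋆ₐ[ℂ] A) : Prop :=
  ∃ u ∈ unitary A, ∀ x : A, θ x = u * x * star u

/-- A *-automorphism is locally inner if for each element `x` there is a unitary `u`, which may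
depend on `x`, such that `θ x = u x u*`. -/
def IsLocallyInnerAut {A : Type*} [Ring A] [StarRing A] [Algebra ℂ A] (θ : A ≃⋆ₐ[ℂ] A) : Prop :=
  ∀ x : A, ∃ u ∈ unitary A, θ x = u * x * star u

end

/-! Local innerness at `a + I • b`, with `a = s + s*` and `b = t + t*`, gives one unitary for both
self-adjoint parts. In L(F_J) the commutant of `λ_s + λ_s*` equals that of `λ_s` for a generator
`s`, so this unitary implements `θ` on any two generators (`exists_unitary_conj_generators`).
Normalize `θ` to fix generators i ≠ j. For k ≠ j choose u for the pair (i, k) and v for (j, k): then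
u, v, v*u commute with the generators i, j, k, so their Fourier coefficients live on the
corresponding cyclic subgroups. Comparing coefficients in u = v(v*u) forces v to be scalar, so k is
fixed (`fixes_generator_of_fixes_pair`). Thus all `λ_g` are fixed, and preservation of the trace
gives the identity. -/

open scoped ENNReal

noncomputable section

open scoped ComplexConjugate InnerProductSpace

/-! ### Point masses and square-summability -/

namespace EllTwo

/-- The point mass `δ_g` in `ℓ²(G)`. -/
def pointMass {G : Type*} (g : G) : EllTwo G := by
  classical exact lp.single 2 g 1

theorem inner_pointMass_left {G : Type*} (g : G) (f : EllTwo G) :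
    ⟪pointMass g, f⟫_ℂ = f g := by
  classical
  rw [pointMass, lp.inner_single_left]
  simp

theorem pointMass_self {G : Type*} (g : G) : (pointMass g : EllTwo G) g = 1 := by
  classical
  rw [pointMass, lp.single_apply_self]

theorem pointMass_of_ne {G : Type*} {g h : G} (hne : h ≠ g) :
    (pointMass g : EllTwo G) h = 0 := by
  classical
  rw [pointMass, lp.single_apply_ne _ _ _ hne]

theorem pointMass_apply_equiv {G : Type*} (e : G ≃ G) (g h : G) :
    (pointMass g : EllTwo G) (e h) = (pointMass (e.symm g) : EllTwo G) h := by
  by_cases hh : e h = g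
  · subst hh
    rw [pointMass_self, e.symm_apply_apply, pointMass_self]
  · rw [pointMass_of_ne hh, pointMass_of_ne]
    rintro rfl
    exact hh (e.apply_symm_apply g)

/-- Source of all vanishing of coefficients: invariance along an infinite orbit contradicts
square-summability. -/
theorem eq_zero_of_injective {G : Type*} (f : EllTwo G) (φ : ℕ → G)
    (hφ : Function.Injective φ) (c : ℂ) (hc : ∀ n, f (φ n) = c) : c = 0 := by
  have hf := lp.memℓp f
  rw [memℓp_gen_iff (by norm_num)] at hf
  have h2 := hf.comp_injective hφ
  have h3 : Summable fun _ : ℕ => ‖c‖ ^ (2 : ℝ≥0∞).toReal := by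
    refine h2.congr fun n => ?_
    simp only [Function.comp_apply, hc]
  have h4 := (summable_const_iff _).1 h3
  rw [Real.rpow_eq_zero (norm_nonneg c) (by norm_num)] at h4
  exact norm_eq_zero.1 h4

end EllTwo

open EllTwo

/-! ### Left and right regular representations -/

section Regular

variable {G : Type*} [Group G]

/-- The right translations `(ρ_g f)(h) = f (h g)` of `ℓ²(G)`. -/
def rightRegular (g : G) : EllTwo G →L[ℂ] EllTwo G :=
  LinearIsometry.toContinuousLinearMap
    { toFun := fun f =>
        (⟨fun h : G => f (h * g), memℓp_two_comp_equiv (Equiv.mulRight g) f⟩ : EllTwo G)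
      map_add' := fun _ _ => rfl
      map_smul' := fun _ _ => rfl
      norm_map' := fun f => by
        have h2 : 0 < (2 : ℝ≥0∞).toReal := by norm_num
        rw [lp.norm_eq_tsum_rpow h2, lp.norm_eq_tsum_rpow h2]
        congr 1
        exact (Equiv.mulRight g).tsum_eq (fun h : G => ‖f h‖ ^ (2 : ℝ≥0∞).toReal) }

theorem rightRegular_apply (g : G) (f : EllTwo G) (h : G) :
    rightRegular g f h = f (h * g) := rfl

theorem leftRegular_mul (g h : G) : leftRegular (g * h) = leftRegular g * leftRegular h := by
  ext f k
  simp only [mul_apply_eq_comp, leftRegular_apply, mul_inv_rev, mul_assoc]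

theorem leftRegular_one : leftRegular (1 : G) = 1 := by
  ext f k
  simp only [one_apply_eq_self, leftRegular_apply, inv_one, one_mul]

theorem star_leftRegular (g : G) : star (leftRegular g) = leftRegular g⁻¹ := by
  rw [ContinuousLinearMap.star_eq_adjoint, eq_comm, ContinuousLinearMap.eq_adjoint_iff]
  intro x y
  rw [lp.inner_eq_tsum, lp.inner_eq_tsum, ← (Equiv.mulLeft g⁻¹).tsum_eq]
  refine tsum_congr fun h => ?_
  simp [leftRegular_apply]

theorem rightRegular_pointMass (g h : G) :
    rightRegular g (pointMass h) = pointMass (h * g⁻¹) := by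
  ext k
  rw [rightRegular_apply]
  exact pointMass_apply_equiv (Equiv.mulRight g) h k

theorem leftRegular_pointMass (g h : G) :
    leftRegular g (pointMass h) = pointMass (g * h) := by
  ext k
  rw [leftRegular_apply]
  have := pointMass_apply_equiv (Equiv.mulLeft g⁻¹) h k
  simpa using this

theorem coe_groupVonNeumannAlgebra :
    (groupVonNeumannAlgebra G : Set (EllTwo G →L[ℂ] EllTwo G)) =
      Set.centralizer (Set.centralizer (Set.range (leftRegular (G := G)))) := by
  have h : star (Set.range (leftRegular (G := G))) ⊆ Set.range leftRegular := by
    rintro x ⟨g, hg⟩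
    refine ⟨g⁻¹, ?_⟩
    rw [← star_leftRegular, hg, star_star]
  rw [groupVonNeumannAlgebra, coe_vonNeumannGenerated, Set.union_eq_left.2 h]

theorem leftRegular_mem (g : G) :
    leftRegular g ∈ (groupVonNeumannAlgebra G).toStarSubalgebra := by
  change leftRegular g ∈ (groupVonNeumannAlgebra G : Set (EllTwo G →L[ℂ] EllTwo G))
  rw [coe_groupVonNeumannAlgebra]
  exact Set.subset_centralizer_centralizer ⟨g, rfl⟩

theorem rightRegular_mul_comm {x : EllTwo G →L[ℂ] EllTwo G}
    (hx : x ∈ (groupVonNeumannAlgebra G).toStarSubalgebra) (g : G) :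
    rightRegular g * x = x * rightRegular g := by
  replace hx : x ∈ (groupVonNeumannAlgebra G : Set (EllTwo G →L[ℂ] EllTwo G)) := hx
  rw [coe_groupVonNeumannAlgebra] at hx
  refine hx _ ?_
  rintro _ ⟨h, rfl⟩
  ext f k
  simp only [mul_apply_eq_comp, leftRegular_apply, rightRegular_apply, mul_assoc]

end Regular

/-! ### Fourier coefficients and commutants in L(G) -/

/-- The underlying star-algebra of the group von Neumann algebra `L(G)`. -/
abbrev GroupFactor (G : Type*) [Group G] : Type _ :=
  ↥(groupVonNeumannAlgebra G).toStarSubalgebra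

namespace GroupFactor

variable {G : Type*} [Group G]

/-- The canonical unitary `λ_g`, as an element of `L(G)`. -/
def lam (g : G) : GroupFactor G := ⟨leftRegular g, leftRegular_mem g⟩

/-- The Fourier coefficients `x δ_1` of `x ∈ L(G)`. -/
def coeff (x : GroupFactor G) : EllTwo G := x.1 (pointMass 1)

theorem lam_mul (g h : G) : lam (g * h) = lam g * lam h := Subtype.ext (leftRegular_mul g h)

theorem lam_one : lam (1 : G) = 1 := Subtype.ext leftRegular_one

theorem star_lam (g : G) : star (lam g) = lam g⁻¹ := Subtype.ext (star_leftRegular g)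

theorem lam_mul_lam_inv (g : G) : lam g * lam g⁻¹ = 1 := by
  rw [← lam_mul, mul_inv_cancel, lam_one]

theorem lam_inv_mul_lam (g : G) : lam g⁻¹ * lam g = 1 := by
  rw [← lam_mul, inv_mul_cancel, lam_one]

theorem coeff_sub (x y : GroupFactor G) (g : G) : coeff (x - y) g = coeff x g - coeff y g := rfl

theorem coeff_add (x y : GroupFactor G) (g : G) : coeff (x + y) g = coeff x g + coeff y g := rfl

theorem coeff_smul (c : ℂ) (x : GroupFactor G) : coeff (c • x) = c • coeff x := rfl

theorem coeff_one : coeff (1 : GroupFactor G) = pointMass 1 := rfl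

theorem apply_pointMass (x : GroupFactor G) (g : G) :
    x.1 (pointMass g) = rightRegular g⁻¹ (coeff x) := by
  have h := DFunLike.congr_fun (rightRegular_mul_comm x.2 g⁻¹) (pointMass 1)
  simp only [mul_apply_eq_comp, rightRegular_pointMass, inv_inv, one_mul] at h
  exact h.symm

theorem apply_pointMass_apply (x : GroupFactor G) (g h : G) :
    x.1 (pointMass g) h = coeff x (h * g⁻¹) := by
  rw [apply_pointMass, rightRegular_apply]

theorem coeff_star (x : GroupFactor G) (g : G) : coeff (star x) g = conj (coeff x g⁻¹) := by
  have h : ⟪pointMass g, (star x).1 (pointMass 1)⟫_ℂ = ⟪x.1 (pointMass g), pointMass 1⟫_ℂ :=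
    ContinuousLinearMap.adjoint_inner_right x.1 _ _
  rw [inner_pointMass_left, ← inner_conj_symm, inner_pointMass_left,
    apply_pointMass_apply x] at h
  rw [← one_mul g⁻¹]
  exact h

theorem coeff_lam_mul (s : G) (x : GroupFactor G) (g : G) :
    coeff (lam s * x) g = coeff x (s⁻¹ * g) := rfl

theorem coeff_mul_lam (s : G) (x : GroupFactor G) (g : G) :
    coeff (x * lam s) g = coeff x (g * s⁻¹) := by
  change x.1 (leftRegular s (pointMass 1)) g = _
  rw [leftRegular_pointMass, mul_one, apply_pointMass_apply]

/-- Elements of `L(G)` are determined by their Fourier coefficients. -/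
theorem ext_coeff {x y : GroupFactor G} (h : ∀ g, coeff x g = coeff y g) : x = y := by
  refine Subtype.ext (ContinuousLinearMap.ext fun ξ => ?_)
  ext g
  have key : ∀ z : GroupFactor G, z.1 ξ g = ⟪(star z).1 (pointMass g), ξ⟫_ℂ := fun z => by
    rw [← inner_pointMass_left g (z.1 ξ)]
    exact (ContinuousLinearMap.adjoint_inner_left z.1 _ _).symm
  have hs : coeff (star x) = coeff (star y) := by
    ext k
    rw [coeff_star, coeff_star, h]
  rw [key, key, apply_pointMass, apply_pointMass, hs]

theorem coeff_mul (x y : GroupFactor G) (g : G) :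
    coeff (x * y) g = ∑' h, coeff x (g * h⁻¹) * coeff y h := by
  have h : ⟪pointMass g, x.1 (coeff y)⟫_ℂ = ⟪(star x).1 (pointMass g), coeff y⟫_ℂ :=
    (ContinuousLinearMap.adjoint_inner_left x.1 _ _).symm
  rw [inner_pointMass_left, lp.inner_eq_tsum] at h
  refine h.trans (tsum_congr fun k => ?_)
  rw [apply_pointMass_apply, coeff_star]
  simp [mul_comm]

/-- The canonical trace `x ↦ ⟨x δ_1, δ_1⟩` is tracial. -/
theorem coeff_mul_one_comm (x y : GroupFactor G) : coeff (x * y) 1 = coeff (y * x) 1 := by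
  rw [coeff_mul, coeff_mul, ← (Equiv.inv G).tsum_eq]
  refine tsum_congr fun k => ?_
  simp [mul_comm]

/-- An element commuting with `λ_s + λ_s*` commutes with `λ_s`, if the maps `g ↦ sⁿ g sⁿ` have
no coincidences. -/
theorem commute_lam_of_commute_add_star {s : G}
    (hs : ∀ g, Function.Injective fun n : ℕ => s ^ n * g * s ^ n) {x : GroupFactor G}
    (hx : Commute x (lam s + star (lam s))) : Commute x (lam s) := by
  -- The hypothesis makes the coefficients of this commutator invariant under g ↦ sgs.
  set y := x * lam s⁻¹ - lam s⁻¹ * x with hy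
  have hyc : ∀ g, coeff y g = coeff x (g * s) - coeff x (s * g) := fun g => by
    rw [hy, coeff_sub, coeff_mul_lam, coeff_lam_mul, inv_inv]
  have hstep : ∀ g, coeff y (s * g * s) = coeff y g := fun g => by
    have h := congrArg (fun z => coeff z (s * g * s)) (show x * (lam s + star (lam s)) = _ from hx)
    simp only [star_lam, mul_add, add_mul, coeff_add, coeff_mul_lam, coeff_lam_mul,
      inv_inv] at h
    rw [hyc, hyc]
    have e1 : s * g * s * s⁻¹ = s * g := by group
    have e2 : s⁻¹ * (s * g * s) = g * s := by group
    rw [e1, e2] at h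
    linear_combination h
  have hiter : ∀ g (n : ℕ), coeff y (s ^ n * g * s ^ n) = coeff y g := fun g n => by
    induction n with
    | zero => simp
    | succ n ih =>
      rw [← ih, ← hstep (s ^ n * g * s ^ n), pow_succ s n]
      rw [pow_mul_comm' s n]
      simp only [mul_assoc, pow_mul_comm' s n]
  have hy0 : x * lam s⁻¹ = lam s⁻¹ * x := by
    refine sub_eq_zero.1 (ext_coeff fun g => ?_)
    exact eq_zero_of_injective (coeff y) _ (hs g) _ (hiter g)
  calc x * lam s = lam s * (lam s⁻¹ * x) * lam s := by
        rw [← mul_assoc, lam_mul_lam_inv, one_mul]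
    _ = lam s * x := by rw [← hy0, mul_assoc, mul_assoc, lam_inv_mul_lam, mul_one]

/-- The Fourier coefficients of an element commuting with `λ_s` vanish at each `g` that commutes
with no positive power of `s`. -/
theorem coeff_eq_zero_of_commute_lam {s : G} {x : GroupFactor G} (hx : Commute x (lam s))
    {g : G} (hg : ∀ n : ℕ, 0 < n → ¬ Commute (s ^ n) g) : coeff x g = 0 := by
  have hstep : ∀ g, coeff x (s * g * s⁻¹) = coeff x g := fun g => by
    have h := congrArg (fun z => coeff z (s * g)) (show x * lam s = _ from hx)
    simp only [coeff_mul_lam, coeff_lam_mul, inv_mul_cancel_left] at h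
    exact h
  refine eq_zero_of_injective (coeff x) (fun n : ℕ => s ^ n * g * (s ^ n)⁻¹) ?_ _ fun n => ?_
  -- A coincidence at m < n would make s^(n-m) commute with g.
  · refine Function.Injective.of_lt_imp_ne fun m n hmn heq => hg (n - m) (by omega) ?_
    obtain ⟨k, rfl⟩ := Nat.exists_eq_add_of_lt hmn
    have hk : m + k + 1 - m = k + 1 := by omega
    rw [hk]
    simp only [add_assoc m k 1, pow_add s m (k + 1), mul_inv_rev, mul_assoc] at heq
    have h2 := mul_left_cancel heq
    simp only [← mul_assoc] at h2
    have h3 := mul_right_cancel h2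
    exact eq_mul_inv_iff_mul_eq.1 h3 |>.symm
  · induction n with
    | zero => simp
    | succ n ih =>
      rw [← ih, ← hstep (s ^ n * g * (s ^ n)⁻¹), pow_succ']
      simp only [mul_assoc, mul_inv_rev]

end GroupFactor

end

/-! ### Centralizers of free generators -/

namespace FreeGroup

variable {J : Type*}

/-- The exponent sum of the generator `j`. -/
def exponentSum [DecidableEq J] (j : J) : FreeGroup J →* Multiplicative ℤ :=
  lift fun i => Multiplicative.ofAdd (if i = j then 1 else 0)

theorem toAdd_exponentSum_of_zpow [DecidableEq J] (j i : J) (n : ℤ) :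
    (exponentSum j (of i ^ n)).toAdd = if i = j then n else 0 := by
  simp [exponentSum]

theorem injective_of_pow_mul_mul_of_pow (j : J) (g : FreeGroup J) :
    Function.Injective fun n : ℕ => of j ^ n * g * of j ^ n := by
  classical
  intro m n h
  have h2 := congrArg (fun x => (exponentSum j x).toAdd) h
  simp [exponentSum] at h2
  omega

/-- Were the first letter of g not j^±1, j^n g would be reduced as written. By length, so would g
j^n, and the first letters would differ. -/
theorem exists_toWord_eq_cons_of_commute_of_pow [DecidableEq J] {j : J} {n : ℕ} (hn : 0 < n) {g : FreeGroup J}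
    (h : Commute (of j ^ n) g) (hg : g ≠ 1) : ∃ b L, g.toWord = (j, b) :: L := by
  rcases hL : g.toWord with _ | ⟨⟨i, b⟩, L⟩
  · exact absurd (toWord_eq_nil_iff.1 hL) hg
  by_cases hij : j = i
  · exact ⟨b, L, by rw [hij]⟩
  exfalso
  have hred : IsReduced (List.replicate n (j, true) ++ (i, b) :: L) := by
    have h0 : IsReduced ((i, b) :: L) := hL ▸ isReduced_toWord
    clear h hn
    induction n with
    | zero => simpa using h0
    | succ n ih =>
      rcases n with _ | n
      · simp only [List.replicate_succ, List.replicate_zero, List.cons_append, List.nil_append,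
          isReduced_cons_cons]
        exact ⟨fun h => absurd h hij, h0⟩
      · simp only [List.replicate_succ, List.cons_append, isReduced_cons_cons] at ih ⊢
        exact ⟨fun _ => trivial, ih⟩
  have hw : (of j ^ n * g).toWord = List.replicate n (j, true) ++ (i, b) :: L := by
    rw [toWord_mul, toWord_of_pow, hL, hred.reduce_eq]
  have hsub := toWord_mul_sublist g (of j ^ n)
  rw [← h.eq, hw, toWord_of_pow, hL] at hsub
  have heq := hsub.eq_of_length (by simp; omega)
  obtain ⟨n, rfl⟩ := Nat.exists_eq_succ_of_ne_zero hn.ne'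
  simp only [List.replicate_succ, List.cons_append, List.cons.injEq, Prod.mk.injEq] at heq
  exact hij heq.1.1

/-- The centralizer of a positive power of a free generator is the cyclic group it generates. -/
theorem mem_zpowers_of_commute_of_pow {j : J} {n : ℕ} (hn : 0 < n) (g : FreeGroup J)
    (h : Commute (of j ^ n) g) : g ∈ Subgroup.zpowers (of j) := by
  classical
  induction hN : g.toWord.length generalizing g with
  | zero =>
    rw [List.length_eq_zero_iff, toWord_eq_nil_iff] at hN
    rw [hN]
    exact one_mem _
  | succ N ih =>
    have hg : g ≠ 1 := by
      rintro rfl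
      simp at hN
    -- Strip the first letter: it commutes with j^n, hence so does the shorter remainder.
    obtain ⟨b, L, hL⟩ := exists_toWord_eq_cons_of_commute_of_pow hn h hg
    have hgL : g = mk [(j, b)] * mk L := by
      rw [← mk_toWord (x := g), hL, mul_mk, List.singleton_append]
    have hj : mk [(j, b)] ∈ Subgroup.zpowers (of j) := by
      cases b
      · exact inv_mem (Subgroup.mem_zpowers (of j))
      · exact Subgroup.mem_zpowers (of j)
    have hLred : IsReduced L := by
      have h0 : IsReduced ((j, b) :: L) := hL ▸ isReduced_toWord
      exact h0.infix (List.suffix_cons _ _).isInfix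
    have hjc : Commute (of j ^ n) (mk [(j, b)]) := by
      obtain ⟨k, hk⟩ := hj
      rw [← hk]
      exact ((Commute.refl (of j)).pow_left n).zpow_right k
    have hmem : mk L ∈ Subgroup.zpowers (of j) := by
      refine ih (mk L) ?_ ?_
      · have : mk L = (mk [(j, b)])⁻¹ * g := by rw [hgL, inv_mul_cancel_left]
        rw [this]
        exact hjc.inv_right.mul_right h
      · rw [toWord_mk, hLred.reduce_eq]
        rw [hL] at hN
        simpa using hN
    rw [hgL]
    exact mul_mem hj hmem

end FreeGroup

noncomputable section

open EllTwo

/-! ### Unitary conjugation in star-algebras -/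

section StarAlgebra

variable {A : Type*} [Ring A] [StarRing A]

theorem commute_star_mul_iff {u w x : A} (hu : u ∈ unitary A) (hw : w ∈ unitary A) :
    Commute (star u * w) x ↔ w * x * star w = u * x * star u := by
  have hu1 := Unitary.star_mul_self_of_mem hu
  have hu2 := Unitary.mul_star_self_of_mem hu
  have hw1 := Unitary.star_mul_self_of_mem hw
  have hw2 := Unitary.mul_star_self_of_mem hw
  constructor
  · intro h
    calc w * x * star w = u * (star u * w * x) * star w := by
          simp only [← mul_assoc, hu2, one_mul]
      _ = u * (x * (star u * w)) * star w := by rw [h.eq]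
      _ = u * x * star u := by simp only [mul_assoc, hw2, mul_one]
  · intro h
    calc star u * w * x = star u * (w * x * star w) * w := by
          simp only [mul_assoc, hw1, mul_one]
      _ = star u * (u * x * star u) * w := by rw [h]
      _ = x * (star u * w) := by simp only [← mul_assoc, hu1, one_mul]

theorem commute_iff_conj_eq {w x : A} (hw : w ∈ unitary A) :
    Commute w x ↔ w * x * star w = x := by
  simpa using commute_star_mul_iff (x := x) (one_mem (unitary A)) hw

variable [Algebra ℂ A]

/-- Taking adjoints gives agreement at h - ik as well. -/
theorem StarAlgEquiv.eq_on_parts_of_eq [StarModule ℂ A] (φ ψ : A ≃⋆ₐ[ℂ] A) {h k : A}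
    (hh : star h = h) (hk : star k = k)
    (e : φ (h + Complex.I • k) = ψ (h + Complex.I • k)) : φ h = ψ h ∧ φ k = ψ k := by
  have e' : φ (star (h + Complex.I • k)) = ψ (star (h + Complex.I • k)) := by
    rw [map_star, map_star, e]
  simp only [star_add, star_smul, hh, hk, map_add, map_smul, Complex.star_def,
    Complex.conj_I] at e e'
  refine ⟨?_, smul_right_injective A Complex.I_ne_zero ?_⟩
  · calc φ h = (1 / 2 : ℂ) • (φ h + Complex.I • φ k + (φ h + -Complex.I • φ k)) := by module
      _ = ψ h := by rw [e, e']; module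
  · calc Complex.I • φ k
        = (1 / 2 : ℂ) • (φ h + Complex.I • φ k - (φ h + -Complex.I • φ k)) := by module
      _ = Complex.I • ψ k := by rw [e, e']; module

theorem IsLocallyInnerAut.exists_unitary_conj_pair [StarModule ℂ A] {θ : A ≃⋆ₐ[ℂ] A}
    (hθ : IsLocallyInnerAut θ) {s t : A}
    (hs : ∀ x : A, Commute x (s + star s) → Commute x s)
    (ht : ∀ x : A, Commute x (t + star t) → Commute x t) :
    ∃ u ∈ unitary A, θ s = u * s * star u ∧ θ t = u * t * star u := by
  obtain ⟨u, hu, hux⟩ := hθ (s + star s + Complex.I • (t + star t))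
  have hsa : ∀ y : A, star (y + star y) = y + star y := fun y => by
    rw [star_add, star_star, add_comm]
  obtain ⟨h1, h2⟩ := θ.eq_on_parts_of_eq (Unitary.conjStarAlgAut ℂ A ⟨u, hu⟩) (hsa s) (hsa t) hux
  have key : ∀ y : A, (∀ x : A, Commute x (y + star y) → Commute x y) →
      θ (y + star y) = u * (y + star y) * star u → θ y = u * y * star u := by
    intro y hy hyu
    -- w serves y alone, but u*w commutes with y + y*, hence with y.
    obtain ⟨w, hw, hwy⟩ := hθ y
    rw [hwy]
    refine (commute_star_mul_iff hu hw).1 (hy _ ((commute_star_mul_iff hu hw).2 ?_))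
    rw [← hyu, map_add, map_star, hwy]
    simp only [star_mul, star_star, mul_add, add_mul, mul_assoc]
  exact ⟨u, hu, key s hs h1, key t ht h2⟩

end StarAlgebra

namespace GroupFactor

/-- A locally inner automorphism of `L(G)` preserves the trace, hence is the identity as soon as
it fixes the canonical unitaries. -/
theorem eq_self_of_fixes_lam {G : Type*} [Group G] {θ : GroupFactor G ≃⋆ₐ[ℂ] GroupFactor G}
    (hθ : IsLocallyInnerAut θ) (h : ∀ g, θ (lam g) = lam g) (x : GroupFactor G) : θ x = x := by
  have htr : ∀ y, coeff (θ y) 1 = coeff y 1 := fun y => by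
    obtain ⟨u, hu, huy⟩ := hθ y
    rw [huy, coeff_mul_one_comm, ← mul_assoc, Unitary.star_mul_self_of_mem hu, one_mul]
  refine ext_coeff fun g => ?_
  have e : ∀ y, coeff y g = coeff (lam g⁻¹ * y) 1 := fun y => by
    rw [coeff_lam_mul, inv_inv, mul_one]
  rw [e, e, ← htr (lam g⁻¹ * x), map_mul, h]

/-! ### Rigidity on free generators -/

section Free

variable {J : Type*}

open FreeGroup (of exponentSum)

theorem fixes_lam_of_fixes_generators {θ : FreeGroupFactor J ≃⋆ₐ[ℂ] FreeGroupFactor J}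
    (h : ∀ j, θ (lam (of j)) = lam (of j)) (g : FreeGroup J) : θ (lam g) = lam g := by
  induction g using FreeGroup.induction_on with
  | C1 => rw [lam_one, map_one]
  | of j => exact h j
  | inv_of j ih => rw [← star_lam]; exact (θ.map_star' _).trans (congrArg star ih)
  | mul x y hx hy => rw [lam_mul, map_mul, hx, hy]

theorem coeff_eq_zero_of_notMem_zpowers {j : J} {x : FreeGroupFactor J}
    (hx : Commute x (lam (of j))) {g : FreeGroup J} (hg : g ∉ Subgroup.zpowers (of j)) :
    coeff x g = 0 :=
  coeff_eq_zero_of_commute_lam hx fun _ hn h =>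
    hg (FreeGroup.mem_zpowers_of_commute_of_pow hn g h)

theorem exponentSum_eq_zero_of_mem_zpowers [DecidableEq J] {i j : J} (hij : i ≠ j)
    {g : FreeGroup J} (hg : g ∈ Subgroup.zpowers (of i)) : (exponentSum j g).toAdd = 0 := by
  obtain ⟨k, rfl⟩ := hg
  exact (FreeGroup.toAdd_exponentSum_of_zpow j i k).trans (if_neg hij)

theorem toAdd_exponentSum_zpow_mul_zpow [DecidableEq J] (i j k : J) (m n : ℤ) :
    (exponentSum k (of i ^ m * of j ^ n)).toAdd =
      (if i = k then m else 0) + (if j = k then n else 0) := by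
  rw [map_mul, toAdd_mul, FreeGroup.toAdd_exponentSum_of_zpow,
    FreeGroup.toAdd_exponentSum_of_zpow]

/-- The supports lie in two different cyclic free factors, so only one term of the convolution
survives. -/
theorem coeff_mul_zpow_mul_zpow {i j : J} (hij : i ≠ j) {v w : FreeGroupFactor J}
    (hv : Commute v (lam (of i))) (hw : Commute w (lam (of j))) (m n : ℤ) :
    coeff (v * w) (of i ^ m * of j ^ n) = coeff v (of i ^ m) * coeff w (of j ^ n) := by
  classical
  rw [coeff_mul, tsum_eq_single (of j ^ n), mul_inv_cancel_right]
  intro h hne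
  by_cases hh : h ∈ Subgroup.zpowers (of j)
  · obtain ⟨k, rfl⟩ := hh
    have hkn : k ≠ n := fun e => hne (by rw [e])
    rw [coeff_eq_zero_of_notMem_zpowers hv, zero_mul]
    intro hmem
    have h0 := exponentSum_eq_zero_of_mem_zpowers hij hmem
    have hk : of i ^ m * of j ^ n * (of j ^ k)⁻¹ = of i ^ m * of j ^ (n - k) := by
      rw [mul_assoc, ← zpow_sub]
    change (exponentSum j (of i ^ m * of j ^ n * (of j ^ k)⁻¹)).toAdd = 0 at h0
    rw [hk, toAdd_exponentSum_zpow_mul_zpow, if_neg hij, if_pos rfl] at h0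
    omega
  · rw [coeff_eq_zero_of_notMem_zpowers hw hh, mul_zero]

/-- If `v w` commutes with the generator `i`, where `v` and `w ≠ 0` commute with generators `j`
and `k`, and `i ≠ j ≠ k`, then `v` is a scalar. -/
theorem eq_smul_one_of_commute_generators {i j k : J} (hij : i ≠ j) (hjk : j ≠ k)
    {v w : FreeGroupFactor J} (hw0 : w ≠ 0)
    (hu : Commute (v * w) (lam (of i))) (hv : Commute v (lam (of j)))
    (hw : Commute w (lam (of k))) : v = coeff v 1 • (1 : FreeGroupFactor J) := by
  classical
  obtain ⟨n, hn⟩ : ∃ n : ℤ, coeff w (of k ^ n) ≠ 0 := by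
    by_contra! hall
    refine hw0 (ext_coeff fun g => ?_)
    by_cases hg : g ∈ Subgroup.zpowers (of k)
    · obtain ⟨n, rfl⟩ := hg
      exact hall n
    · exact coeff_eq_zero_of_notMem_zpowers hw hg
  refine ext_coeff fun g => ?_
  rw [coeff_smul, coeff_one, lp.coeFn_smul, Pi.smul_apply, smul_eq_mul]
  by_cases hg1 : g = 1
  · rw [hg1, pointMass_self, mul_one]
  rw [pointMass_of_ne hg1, mul_zero]
  by_cases hg : g ∈ Subgroup.zpowers (of j)
  · obtain ⟨m, rfl⟩ := hg
    change coeff v (of j ^ m) = 0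
    have hm : m ≠ 0 := by
      rintro rfl
      exact hg1 (zpow_zero _)
    refine (mul_eq_zero.1 ?_).resolve_right hn
    -- For m ≠ 0, j^m k^n has nonzero j-exponent, so it lies outside ⟨i⟩, where vw is supported. The
    -- case k = i is allowed.
    rw [← coeff_mul_zpow_mul_zpow hjk hv hw]
    refine coeff_eq_zero_of_notMem_zpowers hu fun hmem => hm ?_
    have h0 := exponentSum_eq_zero_of_mem_zpowers hij hmem
    rwa [toAdd_exponentSum_zpow_mul_zpow, if_pos rfl, if_neg hjk.symm, add_zero] at h0
  · exact coeff_eq_zero_of_notMem_zpowers hv hg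

theorem exists_unitary_conj_generators {θ : FreeGroupFactor J ≃⋆ₐ[ℂ] FreeGroupFactor J}
    (hθ : IsLocallyInnerAut θ) (i j : J) :
    ∃ u ∈ unitary (FreeGroupFactor J), θ (lam (of i)) = u * lam (of i) * star u ∧
      θ (lam (of j)) = u * lam (of j) * star u :=
  hθ.exists_unitary_conj_pair
    (fun _ h => commute_lam_of_commute_add_star
      (FreeGroup.injective_of_pow_mul_mul_of_pow i) h)
    (fun _ h => commute_lam_of_commute_add_star
      (FreeGroup.injective_of_pow_mul_mul_of_pow j) h)

theorem fixes_generator_of_fixes_pair {θ : FreeGroupFactor J ≃⋆ₐ[ℂ] FreeGroupFactor J}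
    (hθ : IsLocallyInnerAut θ) {i j k : J} (hij : i ≠ j) (hjk : j ≠ k)
    (hi : θ (lam (of i)) = lam (of i)) (hj : θ (lam (of j)) = lam (of j)) :
    θ (lam (of k)) = lam (of k) := by
  obtain ⟨u, hu, hui, huk⟩ := exists_unitary_conj_generators hθ i k
  obtain ⟨v, hv, hvj, hvk⟩ := exists_unitary_conj_generators hθ j k
  have hcu : Commute u (lam (of i)) := (commute_iff_conj_eq hu).2 (hui.symm.trans hi)
  have hcv : Commute v (lam (of j)) := (commute_iff_conj_eq hv).2 (hvj.symm.trans hj)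
  have hcw : Commute (star v * u) (lam (of k)) :=
    (commute_star_mul_iff hv hu).2 (huk.symm.trans hvk)
  have huv : v * (star v * u) = u := by
    rw [← mul_assoc, Unitary.mul_star_self_of_mem hv, one_mul]
  have hw0 : star v * u ≠ 0 := by
    intro h0
    rw [h0, mul_zero] at huv
    have h1 := Unitary.star_mul_self_of_mem hu
    rw [← huv, mul_zero] at h1
    have h2 : (coeff (0 : FreeGroupFactor J) 1 : ℂ) = 1 := by
      rw [h1, coeff_one, pointMass_self]
    exact zero_ne_one h2
  have hsc := eq_smul_one_of_commute_generators hij hjk hw0 (huv.symm ▸ hcu) hcv hcw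
  rw [hvk]
  refine (commute_iff_conj_eq hv).1 ?_
  rw [hsc]
  exact (Commute.one_left _).smul_left _

end Free

end GroupFactor

open GroupFactor in
theorem proposition2p3 {J : Type*} (θ : FreeGroupFactor J ≃⋆ₐ[ℂ] FreeGroupFactor J)
    (hθ : IsLocallyInnerAut θ) : IsInnerAut θ := by
  -- The alternatives let one argument cover every size of J: a single generator has no second one
  -- to pair with.
  suffices h : ∃ u ∈ unitary (FreeGroupFactor J), ∀ j : J,
      θ (lam (.of j)) = u * lam (.of j) * star u ∨ ∃ i i' : J, i ≠ i' ∧ i' ≠ j ∧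
        θ (lam (.of i)) = u * lam (.of i) * star u ∧
        θ (lam (.of i')) = u * lam (.of i') * star u by
    obtain ⟨u, hu, h⟩ := h
    have hu1 := Unitary.star_mul_self_of_mem hu
    have hu2 := Unitary.mul_star_self_of_mem hu
    set ψ := θ.trans (Unitary.conjStarAlgAut ℂ _ ⟨u, hu⟩).symm with hψdef
    have hψ : ∀ x, ψ x = star u * θ x * u := fun _ => rfl
    have hψl : IsLocallyInnerAut ψ := fun x => by
      obtain ⟨w, hw, hwx⟩ := hθ x
      refine ⟨star u * w, mul_mem (Unitary.star_mem hu) hw, ?_⟩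
      rw [hψ, hwx, star_mul, star_star]
      simp only [mul_assoc]
    have hfix : ∀ x, θ x = u * x * star u → ψ x = x := fun x hx => by
      rw [hψ, hx]
      simp only [← mul_assoc, hu1, one_mul]
      rw [mul_assoc, hu1, mul_one]
    have hgen : ∀ j : J, ψ (lam (.of j)) = lam (.of j) := fun j => by
      rcases h j with h | ⟨i, i', hne, hne', hi, hi'⟩
      · exact hfix _ h
      · exact fixes_generator_of_fixes_pair hψl hne hne' (hfix _ hi) (hfix _ hi')
    refine ⟨u, hu, fun x => ?_⟩
    have hx := eq_self_of_fixes_lam hψl (fixes_lam_of_fixes_generators hgen) x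
    rw [hψ] at hx
    calc θ x = u * (star u * θ x * u) * star u := by
          simp only [← mul_assoc, hu2, one_mul]
          rw [mul_assoc, hu2, mul_one]
      _ = u * x * star u := by rw [hx]
  rcases isEmpty_or_nonempty J with _ | ⟨⟨i⟩⟩
  · exact ⟨1, one_mem _, isEmptyElim⟩
  by_cases hJ : ∃ i' : J, i ≠ i'
  · obtain ⟨i', hne⟩ := hJ
    obtain ⟨u, hu, hi, hi'⟩ := exists_unitary_conj_generators hθ i i'
    refine ⟨u, hu, fun j => ?_⟩
    by_cases hj : i' = j
    · exact Or.inl (hj ▸ hi')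
    · exact Or.inr ⟨i, i', hne, hj, hi, hi'⟩
  · push Not at hJ
    obtain ⟨u, hu, hi⟩ := hθ (lam (.of i))
    exact ⟨u, hu, fun j => Or.inl (hJ j ▸ hi)⟩

end
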